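/- Consider the basic modal language generated by $\varphi ::= \bot \mid p \mid \neg\varphi \mid \varphi\lor\varphi \mid \Diamond\varphi$, where $p$ ranges over a countably infinite set of propositional variables $p_0,p_1,\dots$; $\land,\to,\leftrightarrow$ are defined as usual, $\Box\varphi := \neg\Diamond\neg\varphi$, and $\Diamond^k$ denotes a string of $k$ diamonds. A \emph{normal modal logic} is a set of formulas that contains all propositional tautologies, all formulas $\Box(\varphi\to\psi)\to(\Box\varphi\to\Box\psi)$ and all formulas $\Diamond\varphi\leftrightarrow\neg\Box\neg\varphi$, and is closed under modus ponens, uniform substitution and necessitation. For a set $\Phi$ of formulas, $\mathbf{K}\oplus\Phi$ denotes the least normal modal logic that contains $\Phi$. Corollary. Let $\Phi$ be a finite set of formulas, each of the form $\Diamond^m p\to\Diamond^n p$ with $p$ a propositional variable and $n>m>1$. Then $\mathbf{K}\oplus\Phi$ is decidable, that is, there is an algorithm that decides, given a formula $\varphi$ (through its Gödel number), whether $\varphi\in\mathbf{K}\oplus\Phi$. -/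

import Mathlib

/-- Formulas of the basic modal language over the propositional variables `p₀, p₁, p₂, …`. -/
inductive ModalFormula : Type where
  | bot : ModalFormula
  | var : ℕ → ModalFormula
  | neg : ModalFormula → ModalFormula
  | or : ModalFormula → ModalFormula → ModalFormula
  | dia : ModalFormula → ModalFormula

namespace ModalFormula

/-- `φ → ψ`, defined as `¬φ ∨ ψ`. -/
def imp (φ ψ : ModalFormula) : ModalFormula := or (neg φ) ψ

/-- `φ ∧ ψ`, defined as `¬(¬φ ∨ ¬ψ)`. -/
def and (φ ψ : ModalFormula) : ModalFormula := neg (or (neg φ) (neg ψ))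

/-- `φ ↔ ψ`, defined as `(φ → ψ) ∧ (ψ → φ)`. -/
def iff (φ ψ : ModalFormula) : ModalFormula := and (imp φ ψ) (imp ψ φ)

/-- `□φ`, defined as `¬◇¬φ`. -/
def box (φ : ModalFormula) : ModalFormula := neg (dia (neg φ))

/-- `◇ᵏφ`, that is, `φ` preceded by `k` diamonds. -/
def diaPow : ℕ → ModalFormula → ModalFormula
  | 0, φ => φ
  | k + 1, φ => dia (diaPow k φ)

/-- Uniform substitution of the formulas `σ i` for the variables `pᵢ`. -/
def subst (σ : ℕ → ModalFormula) : ModalFormula → ModalFormula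
  | bot => bot
  | var i => σ i
  | neg φ => neg (subst σ φ)
  | or φ ψ => or (subst σ φ) (subst σ ψ)
  | dia φ => dia (subst σ φ)

/-- The truth value of a formula under a truth assignment `v` to the variables and to the
formulas that begin with a diamond. -/
def truthValue (v : ModalFormula → Bool) : ModalFormula → Bool
  | bot => false
  | var i => v (var i)
  | neg φ => !(truthValue v φ)
  | or φ ψ => truthValue v φ || truthValue v ψ
  | dia φ => v (dia φ)

/-- Propositional tautologies, including their instances in the modal language. -/
def IsTautology (φ : ModalFormula) : Prop :=
  ∀ v : ModalFormula → Bool, truthValue v φ = true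

/-- The Gödel number of a formula. -/
def toNat : ModalFormula → ℕ
  | bot => 0
  | var i => 4 * i + 1
  | neg φ => 4 * toNat φ + 2
  | or φ ψ => 4 * Nat.pair (toNat φ) (toNat ψ) + 3
  | dia φ => 4 * toNat φ + 4

/-- The formula with a given Gödel number. -/
def ofNat : ℕ → ModalFormula
  | 0 => bot
  | k + 1 =>
    have h₀ : k / 4 < k + 1 := by omega
    have h₁ : (k / 4).unpair.1 < k + 1 := (Nat.unpair_left_le _).trans_lt h₀
    have h₂ : (k / 4).unpair.2 < k + 1 := (Nat.unpair_right_le _).trans_lt h₀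
    match k % 4 with
    | 0 => var (k / 4)
    | 1 => neg (ofNat (k / 4))
    | 2 => or (ofNat (k / 4).unpair.1) (ofNat (k / 4).unpair.2)
    | _ => dia (ofNat (k / 4))

theorem ofNat_toNat (φ : ModalFormula) : ofNat (toNat φ) = φ := by
  induction φ with
  | bot => simp [toNat, ofNat]
  | var i =>
    have h₁ : 4 * i % 4 = 0 := by omega
    have h₂ : 4 * i / 4 = i := by omega
    rw [toNat, ofNat, h₁, h₂]; rfl
  | neg φ ih =>
    have h₁ : (4 * toNat φ + 1) % 4 = 1 := by omega
    have h₂ : (4 * toNat φ + 1) / 4 = toNat φ := by omega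
    simp only [toNat, ofNat, h₁, h₂, ih]
  | or φ ψ ih₁ ih₂ =>
    have h₁ : (4 * Nat.pair (toNat φ) (toNat ψ) + 2) % 4 = 2 := by omega
    have h₂ : (4 * Nat.pair (toNat φ) (toNat ψ) + 2) / 4 = Nat.pair (toNat φ) (toNat ψ) := by
      omega
    rw [toNat, ofNat, h₁, h₂]
    simp [ih₁, ih₂]
  | dia φ ih =>
    have h₁ : (4 * toNat φ + 3) % 4 = 3 := by omega
    have h₂ : (4 * toNat φ + 3) / 4 = toNat φ := by omega
    simp only [toNat, ofNat, h₁, h₂, ih]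

theorem toNat_ofNat (k : ℕ) : toNat (ofNat k) = k := by
  induction k using Nat.strong_induction_on with
  | _ k ih =>
    cases k with
    | zero => simp [ofNat, toNat]
    | succ k =>
      have h₀ : k / 4 < k + 1 := by omega
      have h₁ : (k / 4).unpair.1 < k + 1 := (Nat.unpair_left_le _).trans_lt h₀
      have h₂ : (k / 4).unpair.2 < k + 1 := (Nat.unpair_right_le _).trans_lt h₀
      have h : k % 4 = 0 ∨ k % 4 = 1 ∨ k % 4 = 2 ∨ k % 4 = 3 := by omega
      rcases h with h | h | h | h
      · simp only [ofNat, h, toNat]; omega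
      · simp only [ofNat, h, toNat, ih _ h₀]; omega
      · simp only [ofNat, h, toNat, ih _ h₁, ih _ h₂, Nat.pair_unpair]; omega
      · simp only [ofNat, h, toNat, ih _ h₀]; omega

/-- Gödel numbering is a bijection between formulas and natural numbers. -/
def equivNat : ModalFormula ≃ ℕ where
  toFun := toNat
  invFun := ofNat
  left_inv := ofNat_toNat
  right_inv := toNat_ofNat

/-- Computability of predicates of formulas is understood through the Gödel numbering. -/
instance : Denumerable ModalFormula := Denumerable.mk' equivNat

end ModalFormula

/-- A set of formulas is a normal modal logic if it contains all tautologies, the axiom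
`□(φ → ψ) → (□φ → □ψ)` and the duality axiom `◇φ ↔ ¬□¬φ`, and is closed under modus ponens,
uniform substitution and necessitation. -/
structure IsNormalModalLogic (L : Set ModalFormula) : Prop where
  taut : ∀ φ : ModalFormula, φ.IsTautology → φ ∈ L
  axiomK : ∀ φ ψ : ModalFormula,
    ((φ.imp ψ).box.imp (φ.box.imp ψ.box)) ∈ L
  dual : ∀ φ : ModalFormula, (φ.dia.iff φ.neg.box.neg) ∈ L
  mp : ∀ φ ψ : ModalFormula, φ.imp ψ ∈ L → φ ∈ L → ψ ∈ L
  subst : ∀ (σ : ℕ → ModalFormula) (φ : ModalFormula), φ ∈ L → φ.subst σ ∈ L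
  nec : ∀ φ : ModalFormula, φ ∈ L → φ.box ∈ L

/-- `K ⊕ Φ`, the least normal modal logic that contains `Φ`. -/
def normalExtension (Φ : Set ModalFormula) : Set ModalFormula :=
  {φ | ∀ L : Set ModalFormula, IsNormalModalLogic L → Φ ⊆ L → φ ∈ L}

/-- A logic is decidable if some algorithm decides which formulas belong to it. -/
def IsDecidableLogic (L : Set ModalFormula) : Prop :=
  ComputablePred fun φ : ModalFormula => φ ∈ L

/-!
The logic `K ⊕ Φ` has the finite model property with a computable bound on the size of
countermodels, so that membership of `φ` can be decided by a search through all small models.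

The axiom `◇ᵐp → ◇ⁿp` is canonical and corresponds to the frame condition `Rᵐ ⊆ Rⁿ`, where `Rᵏ`
relates the ends of `R`-paths with `k` steps. Hence every `φ ∉ K ⊕ Φ` is refuted in a Kripke model
`M` with these conditions (`IsNormalModalLogic.exists_not_sat`,
`CanonicalWorld.relPow_of_axiom_mem`).

An ordinary filtration of `M` need not satisfy `Rᵐ ⊆ Rⁿ` again: a path in the filtration is in
general not the image of a path in `M`. The remedy is to let the information about a world decay
along paths. The worlds of the finite model are pairs of a grade `k ≤ D` and a `k`-bisimulation
type of worlds of `M`, taken over finitely many variables; a type of grade `0` carries no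
information. There is an arrow from `(k + 1, t)` to `(l, s)` if `k ≤ l` and the truncation of `s`
to grade `k` is among the successor types recorded in `t`; from grade `0` there are arrows to all
worlds. A formula with Gödel number less than `k` keeps its truth value at worlds of
grade `k` (`sat_gradedCode_iff`).

The condition `Rᵐ ⊆ Rⁿ` with `m < n` is inherited (`relPow_gradedRel`). Let a path with `m` steps
lead from `(k, t)` to `(l, s)`. If `m ≤ k`, then the arrows record enough information to lift the
path to `M`, up to the type of grade `k - m` of its end. There it can be replaced by a path with
`n` steps, and this path is brought back by giving its worlds the grades `k, k - 1, k - 2, …`,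
except that the last one is replaced by `(l, s)`, which agrees with it as far as needed. If
`k < m`, then a descent of `k` steps to grade `0` exists, and as `n > k`, the remaining steps can
lead from there to any world.

The number of types is bounded by an iterated exponential, so all models to be considered can be
coded by the binary digits of numbers below a primitive recursive bound (`exists_bit_model`), and
checking the frame conditions and the truth of a formula in such a model is primitive recursive
(`primrecPred_exists_countermodel`).
-/

/-! ### Kripke semantics and soundness -/

/-- `relPow R n x y` holds if some `R`-path with exactly `n` steps leads from `x` to `y`. -/
def relPow {W : Type*} (R : W → W → Prop) : ℕ → W → W → Prop
  | 0, x, y => x = y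
  | n + 1, x, y => ∃ z, R x z ∧ relPow R n z y

/-- A prefix of any length `k ≤ m` can be taken of a path with `m` steps. -/
theorem relPow_prefix {W : Type*} {R : W → W → Prop} {k m : ℕ} (hkm : k ≤ m) {x y : W}
    (h : relPow R m x y) : ∃ z, relPow R k x z := by
  induction k generalizing m x with
  | zero => exact ⟨x, rfl⟩
  | succ k ih =>
    obtain ⟨m, rfl⟩ : ∃ m', m = m' + 1 := ⟨m - 1, by omega⟩
    obtain ⟨z, hxz, hzy⟩ := h
    obtain ⟨w, hw⟩ := ih (by omega) hzy
    exact ⟨w, z, hxz, hw⟩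

namespace ModalFormula

/-- Truth of a formula at a world of the Kripke model with accessibility relation `R` and
valuation `V`, where `V i x` says that the variable `pᵢ` is true at `x`. -/
def Sat {W : Type*} (R : W → W → Prop) (V : ℕ → W → Prop) : ModalFormula → W → Prop
  | bot, _ => False
  | var i, x => V i x
  | neg φ, x => ¬ Sat R V φ x
  | or φ ψ, x => Sat R V φ x ∨ Sat R V ψ x
  | dia φ, x => ∃ y, R x y ∧ Sat R V φ y

section Semantics

variable {W : Type*} {R : W → W → Prop} {V : ℕ → W → Prop}

theorem sat_imp {φ ψ : ModalFormula} {x : W} :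
    Sat R V (φ.imp ψ) x ↔ (Sat R V φ x → Sat R V ψ x) := by
  simp only [imp, Sat]; tauto

theorem sat_iff {φ ψ : ModalFormula} {x : W} :
    Sat R V (φ.iff ψ) x ↔ (Sat R V φ x ↔ Sat R V ψ x) := by
  simp only [iff, and, imp, Sat]; tauto

theorem sat_box {φ : ModalFormula} {x : W} :
    Sat R V φ.box x ↔ ∀ y, R x y → Sat R V φ y := by
  simp [box, Sat]

theorem sat_diaPow {φ : ModalFormula} {n : ℕ} {x : W} :
    Sat R V (φ.diaPow n) x ↔ ∃ y, relPow R n x y ∧ Sat R V φ y := by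
  induction n generalizing x with
  | zero => simp [diaPow, relPow]
  | succ n ih =>
    simp only [diaPow, Sat, relPow, ih]
    constructor
    · rintro ⟨z, hz, y, hy, h⟩; exact ⟨y, ⟨z, hz, hy⟩, h⟩
    · rintro ⟨y, ⟨z, hz, hy⟩, h⟩; exact ⟨z, hz, y, hy, h⟩

theorem sat_subst {σ : ℕ → ModalFormula} {φ : ModalFormula} {x : W} :
    Sat R V (φ.subst σ) x ↔ Sat R (fun i y => Sat R V (σ i) y) φ x := by
  induction φ generalizing x with
  | bot => rfl
  | var i => rfl
  | neg φ ih => simp only [subst, Sat, ih]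
  | or φ ψ ih₁ ih₂ => simp only [subst, Sat, ih₁, ih₂]
  | dia φ ih => simp only [subst, Sat, ih]

theorem IsTautology.sat {φ : ModalFormula} (h : φ.IsTautology) (x : W) : Sat R V φ x := by
  classical
  have key : ∀ ψ : ModalFormula,
      truthValue (fun χ => decide (Sat R V χ x)) ψ = true ↔ Sat R V ψ x := by
    intro ψ
    induction ψ with
    | bot => simp [truthValue, Sat]
    | var i => simp [truthValue]
    | neg ψ ih => simp [truthValue, Sat, ← ih]
    | or ψ χ ih₁ ih₂ => simp [truthValue, Sat, ← ih₁, ← ih₂]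
    | dia ψ => simp [truthValue]
  exact (key φ).1 (h _)

end Semantics

end ModalFormula

open ModalFormula

/-- The formulas valid on a frame form a normal modal logic. -/
theorem isNormalModalLogic_valid {W : Type*} (R : W → W → Prop) :
    IsNormalModalLogic {φ | ∀ (V : ℕ → W → Prop) (x : W), φ.Sat R V x} where
  taut φ h V x := h.sat x
  axiomK φ ψ V x := by
    simp only [sat_imp, sat_box]
    exact fun h h' y hy => h y hy (h' y hy)
  dual φ V x := by
    simp [sat_iff, sat_box, Sat]
  mp φ ψ h h' V x := sat_imp.1 (h V x) (h' V x)
  subst σ φ h V x := sat_subst.2 (h _ x)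
  nec φ h V x := sat_box.2 fun y _ => h V y

/-! ### The canonical model -/

/-- A theory over a logic `L` is a set of formulas that contains `L` and is closed under
modus ponens; in contrast to `L` it need not be closed under necessitation or substitution. -/
structure IsTheory (L T : Set ModalFormula) : Prop where
  subset : L ⊆ T
  mp : ∀ φ ψ : ModalFormula, φ.imp ψ ∈ T → φ ∈ T → ψ ∈ T

/-- The worlds of the canonical model of `L`: the consistent theories over `L` that decide
every formula. -/
structure CanonicalWorld (L : Set ModalFormula) where
  carrier : Set ModalFormula
  isTheory : IsTheory L carrier
  bot_notMem : bot ∉ carrier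
  mem_or_neg_mem : ∀ φ, φ ∈ carrier ∨ φ.neg ∈ carrier

/-- The canonical accessibility relation. -/
def canonicalRel (L : Set ModalFormula) (T U : CanonicalWorld L) : Prop :=
  ∀ χ ∈ U.carrier, χ.dia ∈ T.carrier

/-- The canonical valuation. -/
def canonicalVal (L : Set ModalFormula) (i : ℕ) (T : CanonicalWorld L) : Prop :=
  var i ∈ T.carrier

section Canonical

variable {L T : Set ModalFormula}

theorem IsTheory.taut_mp (hL : IsNormalModalLogic L) (hT : IsTheory L T) {φ ψ : ModalFormula}
    (h : (φ.imp ψ).IsTautology) (hφ : φ ∈ T) : ψ ∈ T :=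
  hT.mp _ _ (hT.subset (hL.taut _ h)) hφ

theorem IsTheory.taut_mp₂ (hL : IsNormalModalLogic L) (hT : IsTheory L T)
    {φ ψ χ : ModalFormula} (h : (φ.imp (ψ.imp χ)).IsTautology) (hφ : φ ∈ T) (hψ : ψ ∈ T) :
    χ ∈ T :=
  hT.mp _ _ (hT.taut_mp hL h hφ) hψ

theorem IsNormalModalLogic.isTheory (hL : IsNormalModalLogic L) : IsTheory L L :=
  ⟨subset_rfl, hL.mp⟩

theorem IsTheory.box_mp (hL : IsNormalModalLogic L) (hT : IsTheory L T) {φ ψ : ModalFormula}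
    (h : φ.imp ψ ∈ L) (hφ : φ.box ∈ T) : ψ.box ∈ T :=
  hT.mp _ _ (hT.subset (hL.mp _ _ (hL.axiomK _ _) (hL.nec _ h))) hφ

theorem IsTheory.box_mp₂ (hL : IsNormalModalLogic L) (hT : IsTheory L T)
    {φ ψ χ : ModalFormula} (h : φ.imp (ψ.imp χ) ∈ L) (hφ : φ.box ∈ T) (hψ : ψ.box ∈ T) :
    χ.box ∈ T :=
  hT.mp _ _ (hT.mp _ _ (hT.subset (hL.axiomK _ _)) (hT.box_mp hL h hφ)) hψ

/-- A theory that contains both `◇φ` and `□¬φ` is inconsistent. -/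
theorem IsTheory.bot_mem_of_dia_of_box_neg (hL : IsNormalModalLogic L) (hT : IsTheory L T)
    {φ : ModalFormula} (h : φ.dia ∈ T) (h' : φ.neg.box ∈ T) : bot ∈ T := by
  have hd := hT.subset (hL.dual φ)
  have hn : φ.neg.box.neg ∈ T := by
    refine hT.taut_mp₂ hL ?_ hd h
    intro v
    simp only [ModalFormula.iff, ModalFormula.and, ModalFormula.imp, truthValue]
    cases v φ.dia <;> cases truthValue v φ.neg.box <;> rfl
  refine hT.taut_mp₂ hL ?_ hn h'
  intro v
  simp only [ModalFormula.imp, truthValue]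
  cases truthValue v φ.neg.box <;> rfl

theorem IsNormalModalLogic.dia_imp (hL : IsNormalModalLogic L) {φ ψ : ModalFormula}
    (h : φ.imp ψ ∈ L) : φ.dia.imp ψ.dia ∈ L := by
  have hc : ψ.neg.imp φ.neg ∈ L := by
    refine hL.isTheory.taut_mp hL ?_ h
    intro v
    simp only [ModalFormula.imp, truthValue]
    cases truthValue v φ <;> cases truthValue v ψ <;> rfl
  have hb : ψ.neg.box.imp φ.neg.box ∈ L := hL.mp _ _ (hL.axiomK _ _) (hL.nec _ hc)
  refine hL.mp _ _ (hL.isTheory.taut_mp₂ hL ?_ (hL.dual φ) (hL.dual ψ)) hb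
  intro v
  simp only [ModalFormula.iff, ModalFormula.and, ModalFormula.imp, truthValue]
  cases truthValue v φ.neg.box <;> cases truthValue v ψ.neg.box <;>
    cases v φ.dia <;> cases v ψ.dia <;> rfl

theorem IsNormalModalLogic.diaPow_imp (hL : IsNormalModalLogic L) {φ ψ : ModalFormula}
    (h : φ.imp ψ ∈ L) (n : ℕ) : (φ.diaPow n).imp (ψ.diaPow n) ∈ L := by
  induction n with
  | zero => exact h
  | succ n ih => exact hL.dia_imp ih

/-- The lemma of Lindenbaum: a consistent theory extends to a world of the canonical model. -/
theorem exists_canonicalWorld (hL : IsNormalModalLogic L) (hT : IsTheory L T) (hbot : bot ∉ T) :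
    ∃ U : CanonicalWorld L, T ⊆ U.carrier := by
  obtain ⟨M, hTM, hM⟩ := zorn_subset_nonempty {U | IsTheory L U ∧ bot ∉ U} (by
    rintro c hc hchain ⟨U₀, hU₀⟩
    refine ⟨⋃₀ c, ⟨⟨fun φ hφ => ⟨U₀, hU₀, (hc hU₀).1.subset hφ⟩, ?_⟩, ?_⟩,
      fun U hU => Set.subset_sUnion_of_mem hU⟩
    · rintro φ ψ ⟨U₁, hU₁, h₁⟩ ⟨U₂, hU₂, h₂⟩
      rcases hchain.total hU₁ hU₂ with h | h
      · exact ⟨U₂, hU₂, (hc hU₂).1.mp _ _ (h h₁) h₂⟩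
      · exact ⟨U₁, hU₁, (hc hU₁).1.mp _ _ h₁ (h h₂)⟩
    · rintro ⟨U, hU, h⟩
      exact (hc hU).2 h) T ⟨hT, hbot⟩
  refine ⟨⟨M, hM.prop.1, hM.prop.2, fun φ => ?_⟩, hTM⟩
  by_contra! hφ
  -- By maximality, adding `φ` to `M` results in an inconsistent theory.
  have hN : IsTheory L {χ | φ.imp χ ∈ M} := by
    refine ⟨fun χ hχ => ?_, fun χ θ h h' => ?_⟩
    · refine hM.prop.1.taut_mp hL ?_ (hM.prop.1.subset hχ)
      intro v
      simp only [ModalFormula.imp, truthValue]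
      cases truthValue v φ <;> cases truthValue v χ <;> rfl
    · refine hM.prop.1.taut_mp₂ hL ?_ h h'
      intro v
      simp only [ModalFormula.imp, truthValue]
      cases truthValue v φ <;> cases truthValue v χ <;> cases truthValue v θ <;> rfl
  have hMN : M ⊆ {χ | φ.imp χ ∈ M} := fun χ hχ => by
    refine hM.prop.1.taut_mp hL ?_ hχ
    intro v
    simp only [ModalFormula.imp, truthValue]
    cases truthValue v φ <;> cases truthValue v χ <;> rfl
  have hφN : φ ∈ {χ | φ.imp χ ∈ M} := by
    refine hM.prop.1.subset (hL.taut _ ?_)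
    intro v
    simp only [ModalFormula.imp, truthValue]
    cases truthValue v φ <;> rfl
  by_cases hb : φ.imp bot ∈ M
  · refine hφ.2 (hM.prop.1.taut_mp hL ?_ hb)
    intro v
    simp only [ModalFormula.imp, truthValue]
    cases truthValue v φ <;> rfl
  · exact hφ.1 (hM.le_of_ge ⟨hN, hb⟩ hMN hφN)

namespace CanonicalWorld

theorem neg_mem_iff (hL : IsNormalModalLogic L) (T : CanonicalWorld L) {φ : ModalFormula} :
    φ.neg ∈ T.carrier ↔ φ ∉ T.carrier := by
  refine ⟨fun h h' => T.bot_notMem (T.isTheory.taut_mp₂ hL ?_ h h'),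
    fun h => (T.mem_or_neg_mem φ).resolve_left h⟩
  intro v
  simp only [ModalFormula.imp, truthValue]
  cases truthValue v φ <;> rfl

theorem or_mem_iff (hL : IsNormalModalLogic L) (T : CanonicalWorld L) {φ ψ : ModalFormula} :
    φ.or ψ ∈ T.carrier ↔ φ ∈ T.carrier ∨ ψ ∈ T.carrier := by
  constructor
  · intro h
    rcases T.mem_or_neg_mem φ with hφ | hφ
    · exact Or.inl hφ
    · refine Or.inr (T.isTheory.taut_mp₂ hL ?_ h hφ)
      intro v
      simp only [ModalFormula.imp, truthValue]
      cases truthValue v φ <;> cases truthValue v ψ <;> rfl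
  · rintro (h | h) <;>
    · refine T.isTheory.taut_mp hL ?_ h
      intro v
      simp only [ModalFormula.imp, truthValue]
      cases truthValue v φ <;> cases truthValue v ψ <;> rfl

theorem dia_mem_of_box_neg_notMem (hL : IsNormalModalLogic L) (T : CanonicalWorld L)
    {φ : ModalFormula} (h : φ.neg.box ∉ T.carrier) : φ.dia ∈ T.carrier := by
  refine T.isTheory.taut_mp₂ hL ?_ (T.isTheory.subset (hL.dual φ)) ((T.neg_mem_iff hL).2 h)
  intro v
  simp only [ModalFormula.iff, ModalFormula.and, ModalFormula.imp, truthValue]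
  cases truthValue v φ.neg.box <;> cases v φ.dia <;> rfl

/-- If `◇χ ∈ T` for every member `χ` of a set `S` that is closed downwards under conjunctions,
up to provable implication, then some successor of `T` includes `S`. -/
theorem exists_rel_of_directed (hL : IsNormalModalLogic L) (T : CanonicalWorld L)
    {S : Set ModalFormula} (hne : S.Nonempty)
    (hdir : ∀ φ ∈ S, ∀ ψ ∈ S, ∃ χ ∈ S, χ.imp φ ∈ L ∧ χ.imp ψ ∈ L)
    (hS : ∀ χ ∈ S, χ.dia ∈ T.carrier) :
    ∃ U : CanonicalWorld L, canonicalRel L T U ∧ S ⊆ U.carrier := by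
  -- The theory generated by `S` and all formulas `θ` with `□θ ∈ T` is consistent.
  have hN : IsTheory L {θ | ∃ χ ∈ S, (χ.imp θ).box ∈ T.carrier} := by
    constructor
    · intro θ hθ
      obtain ⟨χ, hχ⟩ := hne
      refine ⟨χ, hχ, T.isTheory.subset (hL.nec _ (hL.isTheory.taut_mp hL ?_ hθ))⟩
      intro v
      simp only [ModalFormula.imp, truthValue]
      cases truthValue v χ <;> cases truthValue v θ <;> rfl
    · rintro θ η ⟨φ, hφ, h₁⟩ ⟨ψ, hψ, h₂⟩
      obtain ⟨χ, hχ, h₃, h₄⟩ := hdir φ hφ ψ hψ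
      refine ⟨χ, hχ, T.isTheory.box_mp₂ hL (hL.isTheory.taut_mp₂ hL ?_ h₃ h₄) h₁ h₂⟩
      intro v
      simp only [ModalFormula.imp, truthValue]
      cases truthValue v φ <;> cases truthValue v ψ <;> cases truthValue v χ <;>
        cases truthValue v θ <;> cases truthValue v η <;> rfl
  have hbot : bot ∉ {θ | ∃ χ ∈ S, (χ.imp θ).box ∈ T.carrier} := by
    rintro ⟨χ, hχ, h⟩
    refine T.bot_notMem (T.isTheory.bot_mem_of_dia_of_box_neg hL (hS χ hχ)
      (T.isTheory.box_mp hL (hL.taut _ ?_) h))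
    intro v
    simp only [ModalFormula.imp, truthValue]
    cases truthValue v χ <;> rfl
  obtain ⟨U, hU⟩ := exists_canonicalWorld hL hN hbot
  refine ⟨U, fun θ hθ => ?_, fun χ hχ => hU ⟨χ, hχ, T.isTheory.subset (hL.nec _ (hL.taut _ ?_))⟩⟩
  · refine T.dia_mem_of_box_neg_notMem hL fun h => ?_
    obtain ⟨χ, hχ⟩ := hne
    refine (U.neg_mem_iff hL).1 (hU ⟨χ, hχ, T.isTheory.box_mp hL (hL.taut _ ?_) h⟩) hθ
    intro v
    simp only [ModalFormula.imp, truthValue]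
    cases truthValue v χ <;> cases truthValue v θ <;> rfl
  · intro v
    simp only [ModalFormula.imp, truthValue]
    cases truthValue v χ <;> rfl

theorem dia_mem_iff (hL : IsNormalModalLogic L) (T : CanonicalWorld L) {φ : ModalFormula} :
    φ.dia ∈ T.carrier ↔ ∃ U : CanonicalWorld L, canonicalRel L T U ∧ φ ∈ U.carrier := by
  constructor
  · intro h
    have hφφ : φ.imp φ ∈ L := hL.taut _ fun v => by
      simp only [ModalFormula.imp, truthValue]
      cases truthValue v φ <;> rfl
    obtain ⟨U, hU, hS⟩ := T.exists_rel_of_directed hL (S := {φ}) ⟨φ, rfl⟩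
      (by rintro _ rfl _ rfl; exact ⟨_, rfl, hφφ, hφφ⟩) (by rintro _ rfl; exact h)
    exact ⟨U, hU, hS rfl⟩
  · rintro ⟨U, hU, h⟩
    exact hU _ h

theorem sat_iff_mem (hL : IsNormalModalLogic L) {φ : ModalFormula} (T : CanonicalWorld L) :
    φ.Sat (canonicalRel L) (canonicalVal L) T ↔ φ ∈ T.carrier := by
  induction φ generalizing T with
  | bot => simp [Sat, T.bot_notMem]
  | var i => rfl
  | neg φ ih => rw [Sat, ih, T.neg_mem_iff hL]
  | or φ ψ ih₁ ih₂ => rw [Sat, ih₁, ih₂, T.or_mem_iff hL]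
  | dia φ ih => simp only [Sat, ih, T.dia_mem_iff hL]

theorem and_mem_iff (hL : IsNormalModalLogic L) (T : CanonicalWorld L) {φ ψ : ModalFormula} :
    φ.and ψ ∈ T.carrier ↔ φ ∈ T.carrier ∧ ψ ∈ T.carrier := by
  rw [ModalFormula.and, T.neg_mem_iff hL, T.or_mem_iff hL, T.neg_mem_iff hL, T.neg_mem_iff hL]
  tauto

/-- `U` is reached from `T` by a canonical path with `n` steps as soon as `T` contains `◇ⁿχ` for
all `χ ∈ U`. The first step leads to a world that contains all formulas `◇ⁿ⁻¹χ` with `χ ∈ U`. -/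
theorem relPow_iff (hL : IsNormalModalLogic L) {n : ℕ} {T U : CanonicalWorld L} :
    relPow (canonicalRel L) n T U ↔ ∀ χ ∈ U.carrier, χ.diaPow n ∈ T.carrier := by
  induction n generalizing T with
  | zero =>
    constructor
    · rintro rfl χ h; exact h
    · intro h
      have hTU : T.carrier = U.carrier := by
        refine subset_antisymm (fun χ hχ => ?_) h
        by_contra hn
        exact (T.neg_mem_iff hL).1 (h _ ((U.neg_mem_iff hL).2 hn)) hχ
      cases T; cases U; cases hTU; rfl
  | succ n ih =>
    constructor
    · rintro ⟨V, hTV, hVU⟩ χ hχ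
      exact hTV _ (ih.1 hVU χ hχ)
    · intro h
      obtain ⟨V, hTV, hS⟩ := T.exists_rel_of_directed hL
        (S := {θ | ∃ χ ∈ U.carrier, θ = χ.diaPow n})
        ⟨_, _, (U.isTheory.subset (hL.taut bot.neg fun v => rfl)), rfl⟩
        (by
          rintro _ ⟨φ, hφ, rfl⟩ _ ⟨ψ, hψ, rfl⟩
          refine ⟨_, ⟨φ.and ψ, (U.and_mem_iff hL).2 ⟨hφ, hψ⟩, rfl⟩,
            hL.diaPow_imp (hL.taut _ ?_) n, hL.diaPow_imp (hL.taut _ ?_) n⟩ <;>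
          · intro v
            simp only [ModalFormula.and, ModalFormula.imp, truthValue]
            cases truthValue v φ <;> cases truthValue v ψ <;> rfl)
        (by rintro _ ⟨χ, hχ, rfl⟩; exact h χ hχ)
      exact ⟨V, hTV, ih.2 fun χ hχ => hS ⟨χ, hχ, rfl⟩⟩

/-- The axiom `◇ᵐp → ◇ⁿp` is canonical. -/
theorem relPow_of_axiom_mem (hL : IsNormalModalLogic L) {m n i : ℕ}
    (h : ((var i).diaPow m).imp ((var i).diaPow n) ∈ L) {T U : CanonicalWorld L}
    (hTU : relPow (canonicalRel L) m T U) : relPow (canonicalRel L) n T U := by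
  have hsub : ∀ (χ : ModalFormula) (k : ℕ),
      ((var i).diaPow k).subst (fun _ => χ) = χ.diaPow k := by
    intro χ k
    induction k with
    | zero => rfl
    | succ k ih => simp only [diaPow, ModalFormula.subst, ih]
  rw [relPow_iff hL] at hTU ⊢
  intro χ hχ
  have hmem := hL.subst (fun _ => χ) _ h
  rw [ModalFormula.imp, ModalFormula.subst, ModalFormula.subst, hsub, hsub] at hmem
  exact T.isTheory.mp _ _ (T.isTheory.subset hmem) (hTU χ hχ)

end CanonicalWorld

/-- A formula outside a normal modal logic is false at some world of its canonical model. -/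
theorem IsNormalModalLogic.exists_not_sat (hL : IsNormalModalLogic L) {φ : ModalFormula}
    (hφ : φ ∉ L) : ∃ T : CanonicalWorld L, ¬ φ.Sat (canonicalRel L) (canonicalVal L) T := by
  -- The theory generated by `¬φ` is consistent, as `φ ∉ L`.
  have hN : IsTheory L {θ | φ.neg.imp θ ∈ L} := by
    refine ⟨fun χ hχ => hL.isTheory.taut_mp hL ?_ hχ,
      fun χ θ h h' => hL.isTheory.taut_mp₂ hL ?_ h h'⟩
    · intro v
      simp only [ModalFormula.imp, truthValue]
      cases truthValue v φ <;> cases truthValue v χ <;> rfl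
    · intro v
      simp only [ModalFormula.imp, truthValue]
      cases truthValue v φ <;> cases truthValue v χ <;> cases truthValue v θ <;> rfl
  obtain ⟨T, hT⟩ := exists_canonicalWorld hL hN fun h => hφ (hL.isTheory.taut_mp hL (by
    intro v
    simp only [ModalFormula.imp, truthValue]
    cases truthValue v φ <;> rfl) h)
  refine ⟨T, fun h => (T.neg_mem_iff hL).1 (hT ?_) ((T.sat_iff_mem hL).1 h)⟩
  refine hL.taut _ fun v => ?_
  simp only [ModalFormula.imp, truthValue]
  cases truthValue v φ <;> rfl

end Canonical

theorem isNormalModalLogic_normalExtension (Φ : Set ModalFormula) :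
    IsNormalModalLogic (normalExtension Φ) where
  taut φ h _ hL _ := hL.taut φ h
  axiomK φ ψ _ hL _ := hL.axiomK φ ψ
  dual φ _ hL _ := hL.dual φ
  mp φ ψ h h' L hL hΦ := hL.mp φ ψ (h L hL hΦ) (h' L hL hΦ)
  subst σ φ h L hL hΦ := hL.subst σ φ (h L hL hΦ)
  nec φ h L hL hΦ := hL.nec φ (h L hL hΦ)

/-! ### Bit codes -/

open scoped Classical in
/-- The number whose binary digit at position `i < n` is `1` exactly if `P i` holds, and whose
digits at other positions are `0`. -/
noncomputable def bitCode (n : ℕ) (P : ℕ → Prop) : ℕ :=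
  Nat.ofBits fun i : Fin n => decide (P i)

theorem bitCode_lt (n : ℕ) (P : ℕ → Prop) : bitCode n P < 2 ^ n :=
  Nat.ofBits_lt_two_pow _

theorem testBit_bitCode {n i : ℕ} (P : ℕ → Prop) (hi : i < n) :
    (bitCode n P).testBit i = true ↔ P i := by
  simp [bitCode, Nat.testBit_ofBits_lt _ _ hi]

theorem bitCode_eq_iff {n : ℕ} {P Q : ℕ → Prop} :
    bitCode n P = bitCode n Q ↔ ∀ i < n, (P i ↔ Q i) := by
  refine ⟨fun h i hi => ?_, fun h => ?_⟩
  · rw [← testBit_bitCode P hi, ← testBit_bitCode Q hi, h]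
  · refine congrArg Nat.ofBits (funext fun i => ?_)
    exact decide_eq_decide.2 (h i i.2)

theorem pair_lt_sq {x y N : ℕ} (hx : x < N) (hy : y < N) : Nat.pair x y < N ^ 2 :=
  (Nat.pair_lt_max_add_one_sq x y).trans_le (Nat.pow_le_pow_left (max_lt hx hy) 2)

/-! ### Codes of bisimulation types -/

/-- A strict upper bound on `typeCode R V v k`. -/
def typeBound (v : ℕ) : ℕ → ℕ
  | 0 => 1
  | k + 1 => 2 ^ (v + typeBound v k)

theorem typeBound_mono (v : ℕ) {k l : ℕ} (h : k ≤ l) : typeBound v k ≤ typeBound v l := by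
  refine monotone_nat_of_le_succ (fun k => ?_) h
  exact (Nat.le_add_left _ v).trans Nat.lt_two_pow_self.le

section Types

variable {W : Type*} {R : W → W → Prop} {V : ℕ → W → Prop} {v : ℕ}

/-- The code of the type of grade `k` of the world `x`. At grade `0` the type carries no
information. At grade `k + 1` it records which of the first `v` variables are true at `x` (in
the binary digits below `v`) and which types of grade `k` the successors of `x` have (in the
other digits). -/
noncomputable def typeCode (R : W → W → Prop) (V : ℕ → W → Prop) (v : ℕ) : ℕ → W → ℕ
  | 0, _ => 0
  | k + 1, x => bitCode (v + typeBound v k) fun i =>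
      if i < v then V i x else ∃ y, R x y ∧ v + typeCode R V v k y = i

theorem typeCode_lt (k : ℕ) (x : W) : typeCode R V v k x < typeBound v k := by
  cases k with
  | zero => simp [typeCode, typeBound]
  | succ k => exact bitCode_lt _ _

theorem typeCode_succ_eq_iff {k : ℕ} {x x' : W} :
    typeCode R V v (k + 1) x = typeCode R V v (k + 1) x' ↔
      (∀ i < v, V i x ↔ V i x') ∧ ∀ t, (∃ y, R x y ∧ typeCode R V v k y = t) ↔
        ∃ y, R x' y ∧ typeCode R V v k y = t := by
  rw [typeCode, typeCode, bitCode_eq_iff]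
  constructor
  · refine fun h => ⟨fun i hi => ?_, fun t => ?_⟩
    · simpa [hi] using h i (by omega)
    · by_cases ht : t < typeBound v k
      · simpa using h (v + t) (by omega)
      · refine iff_of_false ?_ ?_ <;>
        · rintro ⟨y, -, rfl⟩
          exact ht (typeCode_lt k y)
  · rintro ⟨h₁, h₂⟩ i -
    by_cases hi : i < v
    · simpa [hi] using h₁ i hi
    · obtain ⟨t, rfl⟩ := Nat.exists_eq_add_of_le (not_lt.1 hi)
      simpa using h₂ t

theorem exists_rel_of_typeCode_eq {k : ℕ} {x x' y : W}
    (h : typeCode R V v (k + 1) x = typeCode R V v (k + 1) x') (hy : R x y) :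
    ∃ y', R x' y' ∧ typeCode R V v k y' = typeCode R V v k y :=
  ((typeCode_succ_eq_iff.1 h).2 _).1 ⟨y, hy, rfl⟩

theorem typeCode_eq_of_succ {k : ℕ} {x x' : W}
    (h : typeCode R V v (k + 1) x = typeCode R V v (k + 1) x') :
    typeCode R V v k x = typeCode R V v k x' := by
  induction k generalizing x x' with
  | zero => rfl
  | succ k ih =>
    refine typeCode_succ_eq_iff.2 ⟨(typeCode_succ_eq_iff.1 h).1, fun t => ⟨?_, ?_⟩⟩
    · rintro ⟨y, hy, rfl⟩
      obtain ⟨y', hy', he⟩ := exists_rel_of_typeCode_eq h hy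
      exact ⟨y', hy', ih he⟩
    · rintro ⟨y, hy, rfl⟩
      obtain ⟨y', hy', he⟩ := exists_rel_of_typeCode_eq h.symm hy
      exact ⟨y', hy', ih he⟩

theorem typeCode_eq_of_le {k l : ℕ} (hkl : k ≤ l) {x x' : W}
    (h : typeCode R V v l x = typeCode R V v l x') :
    typeCode R V v k x = typeCode R V v k x' := by
  induction l, hkl using Nat.le_induction with
  | base => exact h
  | succ l _ ih => exact ih (typeCode_eq_of_succ h)

/-! ### The graded model -/

/-- The accessibility relation between graded worlds `(k, x)`, where `k ≤ D`. A world of grade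
`k` stands for `x` with only its type of grade `k` known. In a step to `(l, y)` at most one
grade is lost, and some successor of `x` has the same type of grade `k - 1` as `y`. From grade
`0` everything is accessible. -/
def gradedRel (R : W → W → Prop) (V : ℕ → W → Prop) (v D : ℕ) (a b : ℕ × W) : Prop :=
  a.1 ≤ D ∧ b.1 ≤ D ∧ (a.1 = 0 ∨ (a.1 ≤ b.1 + 1 ∧
    ∃ y, R a.2 y ∧ typeCode R V v (a.1 - 1) y = typeCode R V v (a.1 - 1) b.2))

/-- The code of a graded world. -/
noncomputable def gradedCode (R : W → W → Prop) (V : ℕ → W → Prop) (v : ℕ) (a : ℕ × W) : ℕ :=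
  Nat.pair a.1 (typeCode R V v a.1 a.2)

variable {D : ℕ}

theorem gradedCode_eq_iff {a b : ℕ × W} : gradedCode R V v a = gradedCode R V v b ↔
    a.1 = b.1 ∧ typeCode R V v a.1 a.2 = typeCode R V v a.1 b.2 := by
  rw [gradedCode, gradedCode, Nat.pair_eq_pair]
  exact and_congr_right fun h => by rw [h]

theorem gradedRel_congr {a a' b b' : ℕ × W} (ha : gradedCode R V v a = gradedCode R V v a')
    (hb : gradedCode R V v b = gradedCode R V v b') (h : gradedRel R V v D a b) :
    gradedRel R V v D a' b' := by
  obtain ⟨k, x⟩ := a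
  obtain ⟨k', x'⟩ := a'
  obtain ⟨l, y⟩ := b
  obtain ⟨l', y'⟩ := b'
  rw [gradedCode_eq_iff] at ha hb
  obtain ⟨rfl, ha⟩ := ha
  obtain ⟨rfl, hb⟩ := hb
  refine ⟨h.1, h.2.1, ?_⟩
  rcases h.2.2 with h | ⟨hle, z, hz, he⟩
  · exact Or.inl h
  · cases k with
    | zero => exact Or.inl rfl
    | succ k =>
      simp only [Nat.add_sub_cancel, Nat.add_le_add_iff_right] at hle he ha hb ⊢
      obtain ⟨z', hz', he'⟩ := exists_rel_of_typeCode_eq ha hz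
      exact Or.inr ⟨hle, z', hz', he'.trans (he.trans (typeCode_eq_of_le hle hb))⟩

theorem relPow_gradedRel_le {m : ℕ} (hm : 1 ≤ m) {a b : ℕ × W}
    (h : relPow (gradedRel R V v D) m a b) : a.1 ≤ D ∧ b.1 ≤ D := by
  induction m, hm using Nat.le_induction generalizing a with
  | base =>
    obtain ⟨c, hac, rfl⟩ := h
    exact ⟨hac.1, hac.2.1⟩
  | succ m _ ih =>
    obtain ⟨c, hac, hcb⟩ := h
    exact ⟨hac.1, (ih hcb).2⟩

/-- As long as the grade suffices, a path of the graded model is the image of a path of the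
original model, which ends in a world of the same type as the end of the given path, up to the
grade that is left. -/
theorem exists_relPow_of_relPow_gradedRel {m k : ℕ} {a b : ℕ × W} {x : W}
    (h : relPow (gradedRel R V v D) m a b) (hmk : m ≤ k) (hk : k ≤ a.1)
    (hx : typeCode R V v k x = typeCode R V v k a.2) :
    k - m ≤ b.1 ∧ ∃ y, relPow R m x y ∧ typeCode R V v (k - m) y = typeCode R V v (k - m) b.2 := by
  induction m generalizing a x k with
  | zero =>
    cases h
    exact ⟨hk, x, rfl, hx⟩
  | succ m ih =>
    obtain ⟨c, hac, hcb⟩ := h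
    obtain ⟨k, rfl⟩ : ∃ k', k = k' + 1 := ⟨k - 1, by omega⟩
    rcases hac.2.2 with h0 | ⟨hle, y, hy, he⟩
    · omega
    obtain ⟨z, hz, hez⟩ := exists_rel_of_typeCode_eq (k := k) (x := a.2) (x' := x) hx.symm hy
    have hzc := hez.trans (typeCode_eq_of_le (by omega) he)
    obtain ⟨h₁, w, hw, hwb⟩ := ih hcb (by omega) (by omega) hzc
    rw [Nat.add_sub_add_right]
    exact ⟨h₁, w, ⟨z, hz, hw⟩, hwb⟩

/-- Conversely, a path of the original model yields a path of the graded model along which one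
grade is lost at each step. Its last world may be any `b` that agrees with the end of the
original path up to the grade that is left. -/
theorem relPow_gradedRel_of_relPow {n : ℕ} (hn : 1 ≤ n) {a b : ℕ × W} {y : W}
    (h : relPow R n a.2 y) (ha : a.1 ≤ D) (hb : b.1 ≤ D) (hle : a.1 - n ≤ b.1)
    (hy : typeCode R V v (a.1 - n) y = typeCode R V v (a.1 - n) b.2) :
    relPow (gradedRel R V v D) n a b := by
  induction n, hn using Nat.le_induction generalizing a with
  | base =>
    obtain ⟨_, hay, rfl⟩ := h
    exact ⟨b, ⟨ha, hb, Or.inr ⟨by omega, _, hay, hy⟩⟩, rfl⟩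
  | succ n _ ih =>
    obtain ⟨z, haz, hzy⟩ := h
    have hsub : a.1 - 1 - n = a.1 - (n + 1) := by omega
    refine ⟨(a.1 - 1, z), ⟨ha, (Nat.sub_le _ _).trans ha, Or.inr ⟨by simp; omega, z, haz, rfl⟩⟩,
      ih hzy ((Nat.sub_le _ _).trans ha) ?_ ?_⟩
    · simpa only [hsub] using hle
    · simpa only [hsub] using hy

/-- From grade `0` every graded world can be reached in any positive number of steps, as one can
stay at the same world for all steps but the last. -/
theorem relPow_gradedRel_of_grade_zero {n : ℕ} (hn : 1 ≤ n) {a b : ℕ × W} (ha : a.1 = 0)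
    (hb : b.1 ≤ D) : relPow (gradedRel R V v D) n a b := by
  induction n, hn using Nat.le_induction with
  | base => exact ⟨b, ⟨by omega, hb, Or.inl ha⟩, rfl⟩
  | succ n _ ih => exact ⟨a, ⟨by omega, by omega, Or.inl ha⟩, ih⟩

theorem relPow_add {X : Type*} {S : X → X → Prop} {m n : ℕ} {x y z : X} (h : relPow S m x y)
    (h' : relPow S n y z) : relPow S (m + n) x z := by
  induction m generalizing x with
  | zero => cases h; simpa using h'
  | succ m ih =>
    obtain ⟨w, hxw, hwy⟩ := h
    rw [Nat.add_right_comm]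
    exact ⟨w, hxw, ih hwy⟩

/-- The graded model inherits the condition `Rᵐ ⊆ Rⁿ`. A path with `m` steps that starts at a
grade of at least `m` is lifted to the original model, replaced there by a path with `n` steps,
and brought back. If the starting grade `k` is less than `m`, then grade `0` can be reached in
`k` steps, and from there every world can be reached in the `n - k > 0` steps that remain. -/
theorem relPow_gradedRel {m n : ℕ} (hm : 1 ≤ m) (hmn : m < n)
    (hR : ∀ x y, relPow R m x y → relPow R n x y) {a b : ℕ × W}
    (h : relPow (gradedRel R V v D) m a b) : relPow (gradedRel R V v D) n a b := by
  obtain ⟨ha, hb⟩ := relPow_gradedRel_le hm h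
  rcases le_or_gt m a.1 with hma | hma
  · obtain ⟨hle, y, hy, he⟩ := exists_relPow_of_relPow_gradedRel h hma le_rfl rfl
    exact relPow_gradedRel_of_relPow (by omega) (hR _ _ hy) ha hb (by omega)
      (typeCode_eq_of_le (by omega) he)
  · obtain ⟨c, hc⟩ := relPow_prefix hma.le h
    obtain ⟨-, y, hy, -⟩ := exists_relPow_of_relPow_gradedRel hc le_rfl le_rfl rfl
    -- Along the lifted prefix of length `a.1` the grade descends from `a.1` to `0`.
    have hzero : relPow (gradedRel R V v D) a.1 a (0, y) := by
      rcases Nat.eq_zero_or_pos a.1 with h0 | h0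
      · rw [h0] at hy ⊢
        cases hy
        exact Prod.ext h0 rfl
      · exact relPow_gradedRel_of_relPow h0 hy ha (Nat.zero_le _) (by simp) (by simp)
    have hsum := relPow_add hzero
      (relPow_gradedRel_of_grade_zero (n := n - a.1) (by omega) rfl hb)
    rwa [Nat.add_sub_cancel' (by omega)] at hsum

/-! ### The finite model -/

theorem relPow_map {X Y : Type*} {S : X → X → Prop} {q : X → Y} {n : ℕ} {a b : X}
    (h : relPow S n a b) : relPow (Relation.Map S q q) n (q a) (q b) := by
  induction n generalizing a with
  | zero => exact congrArg q h
  | succ n ih =>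
    obtain ⟨c, hac, hcb⟩ := h
    exact ⟨q c, ⟨a, c, hac, rfl, rfl⟩, ih hcb⟩

theorem exists_relPow_of_relPow_map {X Y : Type*} {S : X → X → Prop} {q : X → Y}
    (hq : ∀ a b b', q b = q b' → S a b → S a b') {m : ℕ} (hm : 1 ≤ m) {x y : Y}
    (h : relPow (Relation.Map S q q) m x y) : ∃ a b, q a = x ∧ q b = y ∧ relPow S m a b := by
  induction m, hm using Nat.le_induction generalizing x with
  | base =>
    obtain ⟨_, ⟨a, b, hab, rfl, rfl⟩, rfl⟩ := h
    exact ⟨a, b, rfl, rfl, b, hab, rfl⟩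
  | succ m _ ih =>
    obtain ⟨_, ⟨a, c, hac, rfl, rfl⟩, hzy⟩ := h
    obtain ⟨c', b, hc, hb, hcb⟩ := ih hzy
    exact ⟨a, b, rfl, hb, c', hq _ _ _ hc.symm hac, hcb⟩

/-- Formulas whose Gödel number is less than the grade have the same truth value in the original
model and in the quotient of the graded model by equality of codes. Gödel numbers serve here as
a crude bound on both the modal depth and the indices of variables. -/
theorem sat_gradedCode_iff {V' : ℕ → ℕ → Prop}
    (hV : ∀ i < v, ∀ a : ℕ × W, 1 ≤ a.1 → a.1 ≤ D → (V' i (gradedCode R V v a) ↔ V i a.2))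
    {φ : ModalFormula} (hv : φ.toNat ≤ v) {a : ℕ × W} (hφ : φ.toNat < a.1) (ha : a.1 ≤ D) :
    φ.Sat (Relation.Map (gradedRel R V v D) (gradedCode R V v) (gradedCode R V v)) V'
      (gradedCode R V v a) ↔ φ.Sat R V a.2 := by
  induction φ generalizing a with
  | bot => rfl
  | var i =>
    simp only [ModalFormula.toNat] at hv
    exact hV i (by omega) a (by omega) ha
  | neg φ ih =>
    simp only [ModalFormula.toNat] at hv hφ
    simp only [Sat, ih (by omega) (a := a) (by omega) ha]
  | or φ ψ ih₁ ih₂ =>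
    simp only [ModalFormula.toNat] at hv hφ
    have h₁ := Nat.left_le_pair φ.toNat ψ.toNat
    have h₂ := Nat.right_le_pair φ.toNat ψ.toNat
    simp only [Sat, ih₁ (by omega) (a := a) (by omega) ha, ih₂ (by omega) (a := a) (by omega) ha]
  | dia φ ih =>
    simp only [ModalFormula.toNat] at hv hφ
    constructor
    · rintro ⟨_, ⟨a', b, hab, haa, rfl⟩, hb⟩
      obtain ⟨-, hbD, h0 | ⟨hle, y, hy, he⟩⟩ := gradedRel_congr haa rfl hab
      · omega
      refine ⟨y, hy, ?_⟩
      -- Both `y` and `b.2` are taken at grade `a.1 - 1`, where they have the same code.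
      rw [ih (by omega) (by omega) hbD] at hb
      rw [← ih (by omega) (a := (a.1 - 1, b.2)) (by simp; omega) (by simp; omega)] at hb
      rw [← gradedCode_eq_iff (a := (a.1 - 1, y)) (b := (a.1 - 1, b.2)) |>.2 ⟨rfl, he⟩] at hb
      exact (ih (by omega) (a := (a.1 - 1, y)) (by simp; omega) (by simp; omega)).1 hb
    · rintro ⟨y, hy, h⟩
      refine ⟨gradedCode R V v (a.1 - 1, y), ⟨a, (a.1 - 1, y), ⟨ha, ?_, Or.inr ⟨?_, y, hy, rfl⟩⟩,
        rfl, rfl⟩, (ih (by omega) ?_ ?_).2 h⟩ <;>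
      · simp only
        omega

end Types

/-- The accessibility relation on `{0, …, N - 1}` encoded by the binary digits of `c`. -/
def bitRel (N c x y : ℕ) : Prop :=
  x < N ∧ y < N ∧ c.testBit (Nat.pair x y) = true

/-- The valuation encoded by the binary digits of `d`. -/
def bitVal (d i x : ℕ) : Prop :=
  d.testBit (Nat.pair i x) = true

/-- A number of worlds that suffices to refute a formula with Gödel number `e`. -/
def modelSize (e : ℕ) : ℕ :=
  (typeBound e (e + 1) + (e + 2)) ^ 2

/-- The finite model property with an explicit bound: a formula refuted in a model whose
accessibility relation satisfies `Rᵐ ⊆ Rⁿ` for all `(m, n)` in `F` is refuted in such a model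
on `{0, …, N - 1}` with `N = modelSize φ.toNat`. -/
theorem exists_bit_model {W : Type*} {R : W → W → Prop} {V : ℕ → W → Prop} {F : Set (ℕ × ℕ)}
    (hF : ∀ p ∈ F, 1 ≤ p.1 ∧ p.1 < p.2)
    (hR : ∀ p ∈ F, ∀ x y, relPow R p.1 x y → relPow R p.2 x y) {φ : ModalFormula} {x : W}
    (hφ : ¬ φ.Sat R V x) :
    ∃ c < 2 ^ modelSize φ.toNat ^ 2, ∃ d < 2 ^ modelSize φ.toNat ^ 2, ∃ w < modelSize φ.toNat,
      (∀ p ∈ F, ∀ x y, relPow (bitRel (modelSize φ.toNat) c) p.1 x y →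
        relPow (bitRel (modelSize φ.toNat) c) p.2 x y) ∧
      ¬ φ.Sat (bitRel (modelSize φ.toNat) c) (bitVal d) w := by
  set e := φ.toNat with he
  set N := modelSize e with hN
  set E := gradedRel R V e (e + 1) with hE
  set q := gradedCode R V e with hq
  have hqN : ∀ a : ℕ × W, a.1 ≤ e + 1 → q a < N := fun a ha => by
    have h₁ := (typeCode_lt (R := R) (V := V) (v := e) a.1 a.2).trans_le (typeBound_mono e ha)
    exact pair_lt_sq (by omega) (by omega)
  have heN : e ≤ N := by
    rw [hN, modelSize, sq]
    nlinarith [Nat.zero_le (typeBound e (e + 1)), Nat.zero_le e]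
  -- Only numbers that code a graded world occur as ends of arrows; the others are isolated.
  obtain ⟨c, hc, hcb⟩ : ∃ c < 2 ^ N ^ 2, ∀ i < N ^ 2, c.testBit i = true ↔
      Relation.Map E q q i.unpair.1 i.unpair.2 :=
    ⟨_, bitCode_lt _ _, fun i hi => testBit_bitCode _ hi⟩
  obtain ⟨d, hd, hdb⟩ : ∃ d < 2 ^ N ^ 2, ∀ i < N ^ 2, d.testBit i = true ↔
      ∃ a : ℕ × W, q a = i.unpair.2 ∧ 1 ≤ a.1 ∧ V i.unpair.1 a.2 :=
    ⟨_, bitCode_lt _ _, fun i hi => testBit_bitCode _ hi⟩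
  have hrel : bitRel N c = Relation.Map E q q := by
    ext w w'
    constructor
    · rintro ⟨hw, hw', h⟩
      simpa using (hcb _ (pair_lt_sq hw hw')).1 h
    · rintro ⟨a, b, hab, rfl, rfl⟩
      refine ⟨hqN a hab.1, hqN b hab.2.1,
        (hcb _ (pair_lt_sq (hqN a hab.1) (hqN b hab.2.1))).2 ?_⟩
      simpa using ⟨a, b, hab, rfl, rfl⟩
  refine ⟨c, hc, d, hd, q (e + 1, x), hqN _ le_rfl, ?_, ?_⟩
  · intro p hp w w' hww
    rw [hrel] at hww ⊢
    obtain ⟨a, b, rfl, rfl, hab⟩ := exists_relPow_of_relPow_map (S := E) (q := q)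
      (fun a b b' hb => gradedRel_congr rfl hb) (hF p hp).1 hww
    exact relPow_map (relPow_gradedRel (hF p hp).1 (hF p hp).2 (hR p hp) hab)
  · rw [hrel, sat_gradedCode_iff (a := (e + 1, x)) ?_ le_rfl (Nat.lt_succ_self _) le_rfl]
    · exact hφ
    · intro i hi a ha haD
      rw [bitVal, hdb _ (pair_lt_sq (by omega) (hqN a haD))]
      simp only [Nat.unpair_pair]
      constructor
      · rintro ⟨b, hb, -, h⟩
        obtain ⟨k, z⟩ := a
        obtain ⟨k', z'⟩ := b
        obtain ⟨rfl, hb⟩ := gradedCode_eq_iff.1 hb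
        obtain ⟨k, rfl⟩ : ∃ j, k' = j + 1 := ⟨k' - 1, by simp only at ha; omega⟩
        exact ((typeCode_succ_eq_iff.1 hb).1 i hi).1 h
      · exact fun h => ⟨a, rfl, ha, h⟩

/-! ### The decision procedure -/

/-- A quantifier over numbers below a primitive recursive function of the parameter. -/
theorem PrimrecRel.exists_lt_of_primrec {α : Type*} [Primcodable α] {f : α → ℕ} {P : α → ℕ → Prop}
    (hf : Primrec f) (hP : PrimrecRel P) : PrimrecPred fun a => ∃ x < f a, P a x :=
  ((PrimrecRel.exists_mem_list (R := fun x a => P a x) hP.swap).comp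
    (Primrec.list_range.comp hf) Primrec.id).of_eq fun a => by simp

theorem PrimrecRel.forall_lt_of_primrec {α : Type*} [Primcodable α] {f : α → ℕ} {P : α → ℕ → Prop}
    (hf : Primrec f) (hP : PrimrecRel P) : PrimrecPred fun a => ∀ x < f a, P a x :=
  ((PrimrecRel.forall_mem_list (R := fun x a => P a x) hP.swap).comp
    (Primrec.list_range.comp hf) Primrec.id).of_eq fun a => by simp

theorem primrec_pow : Primrec₂ fun m n : ℕ => m ^ n :=
  Primrec₂.unpaired'.1 Nat.Primrec.pow

theorem primrecRel_testBit : PrimrecRel fun c i : ℕ => c.testBit i = true := by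
  refine (Primrec.eq.comp (f := fun p : ℕ × ℕ => p.1 / 2 ^ p.2 % 2) (g := fun _ => 1) ?_
    (Primrec.const 1)).of_eq fun p => ?_
  · exact Primrec.nat_mod.comp (Primrec.nat_div.comp Primrec.fst
      (primrec_pow.comp (Primrec.const 2) Primrec.snd)) (Primrec.const 2)
  · simp [Nat.testBit_eq_decide_div_mod_eq]

section

variable {α : Type*} [Primcodable α]

theorem primrecPred_bitRel {N c x y : α → ℕ} (hN : Primrec N) (hc : Primrec c) (hx : Primrec x)
    (hy : Primrec y) : PrimrecPred fun a => bitRel (N a) (c a) (x a) (y a) :=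
  (Primrec.nat_lt.comp hx hN).and <| (Primrec.nat_lt.comp hy hN).and <|
    primrecRel_testBit.comp hc (Primrec₂.natPair.comp hx hy)

theorem relPow_bitRel_succ {N c n x y : ℕ} : relPow (bitRel N c) (n + 1) x y ↔
    ∃ z < N, bitRel N c x z ∧ relPow (bitRel N c) n z y :=
  exists_congr fun _ => ⟨fun h => ⟨h.1.2.1, h⟩, fun h => h.2⟩

theorem primrecPred_relPow {N c : α → ℕ} (hN : Primrec N) (hc : Primrec c) (n : ℕ) :
    PrimrecPred fun p : α × ℕ × ℕ => relPow (bitRel (N p.1) (c p.1)) n p.2.1 p.2.2 := by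
  induction n with
  | zero => exact Primrec.eq.comp (Primrec.fst.comp Primrec.snd) (Primrec.snd.comp Primrec.snd)
  | succ n ih =>
    refine (PrimrecRel.exists_lt_of_primrec (f := fun p : α × ℕ × ℕ => N p.1)
      (P := fun p z => bitRel (N p.1) (c p.1) p.2.1 z ∧ relPow (bitRel (N p.1) (c p.1)) n z p.2.2)
      (hN.comp Primrec.fst) (PrimrecPred.and ?_ ?_)).of_eq fun p => relPow_bitRel_succ.symm
    · have h₁ : Primrec fun p : (α × ℕ × ℕ) × ℕ => p.1.1 := Primrec.fst.comp Primrec.fst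
      exact primrecPred_bitRel (hN.comp h₁) (hc.comp h₁)
        (Primrec.fst.comp (Primrec.snd.comp Primrec.fst)) Primrec.snd
    · exact ih.comp (f := fun p : (α × ℕ × ℕ) × ℕ => (p.1.1, p.2, p.1.2.2))
        ((Primrec.fst.comp Primrec.fst).pair (Primrec.snd.pair
          (Primrec.snd.comp (Primrec.snd.comp Primrec.fst))))

theorem relPow_bitRel_lt {N c n x y : ℕ} (hn : 1 ≤ n) (h : relPow (bitRel N c) n x y) :
    x < N ∧ y < N := by
  induction n, hn using Nat.le_induction generalizing x with
  | base =>
    obtain ⟨z, hxz, rfl⟩ := h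
    exact ⟨hxz.1, hxz.2.1⟩
  | succ n _ ih =>
    obtain ⟨z, hxz, hzy⟩ := h
    exact ⟨hxz.1, (ih hzy).2⟩

/-- The condition `Rᵐ ⊆ Rⁿ` on a coded accessibility relation is primitive recursive. -/
theorem primrecPred_relPow_subset {N c : α → ℕ} (hN : Primrec N) (hc : Primrec c) {m n : ℕ}
    (hm : 1 ≤ m) : PrimrecPred fun a => ∀ x y, relPow (bitRel (N a) (c a)) m x y →
      relPow (bitRel (N a) (c a)) n x y := by
  refine (PrimrecRel.forall_lt_of_primrec (f := N) (P := fun a x => ∀ y < N a,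
    ¬ relPow (bitRel (N a) (c a)) m x y ∨ relPow (bitRel (N a) (c a)) n x y) hN
    (PrimrecRel.forall_lt_of_primrec (f := fun p : α × ℕ => N p.1) (P := fun p y =>
      ¬ relPow (bitRel (N p.1) (c p.1)) m p.2 y ∨ relPow (bitRel (N p.1) (c p.1)) n p.2 y)
      (hN.comp Primrec.fst) (PrimrecPred.or (PrimrecPred.not ?_) ?_))).of_eq fun a => ?_
  · exact (primrecPred_relPow hN hc m).comp (f := fun p : (α × ℕ) × ℕ => (p.1.1, p.1.2, p.2))
      ((Primrec.fst.comp Primrec.fst).pair ((Primrec.snd.comp Primrec.fst).pair Primrec.snd))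
  · exact (primrecPred_relPow hN hc n).comp (f := fun p : (α × ℕ) × ℕ => (p.1.1, p.1.2, p.2))
      ((Primrec.fst.comp Primrec.fst).pair ((Primrec.snd.comp Primrec.fst).pair Primrec.snd))
  · constructor
    · intro h x y hxy
      obtain ⟨hx, hy⟩ := relPow_bitRel_lt hm hxy
      exact (h x hx y hy).resolve_left (not_not.2 hxy)
    · intro h x _ y _
      exact (em _).symm.imp_right (h x y)

theorem primrecPred_relPow_subset_of_finite {N c : α → ℕ} (hN : Primrec N) (hc : Primrec c)
    {F : Set (ℕ × ℕ)} (hfin : F.Finite) (hF : ∀ p ∈ F, 1 ≤ p.1) :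
    PrimrecPred fun a => ∀ p ∈ F, ∀ x y, relPow (bitRel (N a) (c a)) p.1 x y →
      relPow (bitRel (N a) (c a)) p.2 x y := by
  induction F, hfin using Set.Finite.induction_on with
  | empty =>
    have h : PrimrecPred fun _ : α => (0 : ℕ) = 0 :=
      Primrec.eq.comp (Primrec.const 0) (Primrec.const 0)
    exact h.of_eq fun a => by simp
  | insert _ _ ih =>
    rename_i p F _ _
    exact ((primrecPred_relPow_subset hN hc (hF p (Set.mem_insert _ _)) (n := p.2)).and
      (ih fun p hp => hF p (Set.mem_insert_of_mem _ hp))).of_eq fun a => by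
        rw [Set.forall_mem_insert]

end

open scoped Classical in
/-- The worlds of a coded model at which the formula with Gödel number `k` is true. The triple
`a` consists of the number of worlds, the code of the relation and the code of the valuation. -/
noncomputable def truthList (a : ℕ × ℕ × ℕ) (k : ℕ) : List ℕ :=
  (List.range a.1).filter fun x => (ofNat k).Sat (bitRel a.1 a.2.1) (bitVal a.2.2) x

theorem mem_truthList {a : ℕ × ℕ × ℕ} {k x : ℕ} : x ∈ truthList a k ↔
    x < a.1 ∧ (ofNat k).Sat (bitRel a.1 a.2.1) (bitVal a.2.2) x := by
  simp [truthList]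

/-- Whether the formula with Gödel number `l.length` is true at `x`, given the list `l` of the
truth lists of all formulas with smaller Gödel numbers. -/
def truthStep (a : ℕ × ℕ × ℕ) (l : List (List ℕ)) (x : ℕ) : Prop :=
  1 ≤ l.length ∧
    (((l.length - 1) % 4 = 0 ∧ bitVal a.2.2 ((l.length - 1) / 4) x) ∨
      ((l.length - 1) % 4 = 1 ∧ ¬ x ∈ l.getD ((l.length - 1) / 4) []) ∨
      ((l.length - 1) % 4 = 2 ∧ (x ∈ l.getD ((l.length - 1) / 4).unpair.1 [] ∨
        x ∈ l.getD ((l.length - 1) / 4).unpair.2 [])) ∨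
      ((l.length - 1) % 4 = 3 ∧
        ∃ y ∈ l.getD ((l.length - 1) / 4) [], bitRel a.1 a.2.1 x y))

theorem truthStep_iff {a : ℕ × ℕ × ℕ} {k x : ℕ} (hx : x < a.1) :
    truthStep a ((List.range k).map (truthList a)) x ↔
      (ofNat k).Sat (bitRel a.1 a.2.1) (bitVal a.2.2) x := by
  have hget : ∀ i < k, ((List.range k).map (truthList a)).getD i [] = truthList a i := by
    intro i hi
    simp [List.getD_eq_getElem?_getD, hi]
  cases k with
  | zero => simp [truthStep, ofNat, Sat]
  | succ k =>
    have h₀ : k / 4 < k + 1 := by omega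
    have h₁ : (k / 4).unpair.1 < k + 1 := (Nat.unpair_left_le _).trans_lt h₀
    have h₂ : (k / 4).unpair.2 < k + 1 := (Nat.unpair_right_le _).trans_lt h₀
    simp only [truthStep, List.length_map, List.length_range, Nat.add_sub_cancel, hget _ h₀,
      hget _ h₁, hget _ h₂, mem_truthList, hx, true_and]
    have h : k % 4 = 0 ∨ k % 4 = 1 ∨ k % 4 = 2 ∨ k % 4 = 3 := by omega
    rcases h with h | h | h | h
    · simp [ofNat, h, Sat]
    · simp [ofNat, h, Sat]
    · simp [ofNat, h, Sat]
    · simp only [ofNat, h, Sat]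
      simp only [bitRel, hx]
      constructor
      · rintro ⟨-, h | h | h | ⟨-, y, ⟨hy, hs⟩, hb⟩⟩
        · omega
        · omega
        · omega
        · exact ⟨y, hb, hs⟩
      · rintro ⟨y, hb, hs⟩
        exact ⟨by omega, Or.inr (Or.inr (Or.inr ⟨trivial, y, ⟨hb.2.1, hs⟩, hb⟩))⟩

theorem primrecPred_truthStep : PrimrecPred fun p : ((ℕ × ℕ × ℕ) × List (List ℕ)) × ℕ =>
    truthStep p.1.1 p.1.2 p.2 := by
  have ha : Primrec fun p : ((ℕ × ℕ × ℕ) × List (List ℕ)) × ℕ => p.1.1 :=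
    Primrec.fst.comp Primrec.fst
  have hl : Primrec fun p : ((ℕ × ℕ × ℕ) × List (List ℕ)) × ℕ => p.1.2 :=
    Primrec.snd.comp Primrec.fst
  have hlen : Primrec fun p : ((ℕ × ℕ × ℕ) × List (List ℕ)) × ℕ => p.1.2.length :=
    Primrec.list_length.comp hl
  have hk : Primrec fun p : ((ℕ × ℕ × ℕ) × List (List ℕ)) × ℕ => p.1.2.length - 1 :=
    Primrec.nat_sub.comp hlen (Primrec.const 1)
  have hmod : ∀ r, PrimrecPred fun p : ((ℕ × ℕ × ℕ) × List (List ℕ)) × ℕ =>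
      (p.1.2.length - 1) % 4 = r := fun r =>
    Primrec.eq.comp (Primrec.nat_mod.comp hk (Primrec.const 4)) (Primrec.const r)
  have hdiv : Primrec fun p : ((ℕ × ℕ × ℕ) × List (List ℕ)) × ℕ => (p.1.2.length - 1) / 4 :=
    Primrec.nat_div.comp hk (Primrec.const 4)
  have hmem : ∀ f : ((ℕ × ℕ × ℕ) × List (List ℕ)) × ℕ → ℕ, Primrec f →
      PrimrecPred fun p : ((ℕ × ℕ × ℕ) × List (List ℕ)) × ℕ => p.2 ∈ p.1.2.getD (f p) [] :=
    fun f hf => ((PrimrecRel.exists_mem_list (R := fun y x : ℕ => y = x) Primrec.eq).comp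
      ((Primrec.list_getD []).comp hl hf) Primrec.snd).of_eq fun p => by simp
  have hvar : PrimrecPred fun p : ((ℕ × ℕ × ℕ) × List (List ℕ)) × ℕ =>
      bitVal p.1.1.2.2 ((p.1.2.length - 1) / 4) p.2 :=
    primrecRel_testBit.comp (Primrec.snd.comp (Primrec.snd.comp ha))
      (Primrec₂.natPair.comp hdiv Primrec.snd)
  have hrel : PrimrecRel fun (y : ℕ) (p : ((ℕ × ℕ × ℕ) × List (List ℕ)) × ℕ) =>
      bitRel p.1.1.1 p.1.1.2.1 p.2 y :=
    primrecPred_bitRel (Primrec.fst.comp (ha.comp Primrec.snd))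
      (Primrec.fst.comp (Primrec.snd.comp (ha.comp Primrec.snd)))
      (Primrec.snd.comp Primrec.snd) Primrec.fst
  have hdia : PrimrecPred fun p : ((ℕ × ℕ × ℕ) × List (List ℕ)) × ℕ =>
      ∃ y ∈ p.1.2.getD ((p.1.2.length - 1) / 4) [], bitRel p.1.1.1 p.1.1.2.1 p.2 y :=
    hrel.exists_mem_list.comp ((Primrec.list_getD []).comp hl hdiv) Primrec.id
  have hunpair := Primrec.unpair.comp hdiv
  exact (Primrec.nat_le.comp (Primrec.const 1) hlen).and <|
    ((hmod 0).and hvar).or <| ((hmod 1).and (hmem _ hdiv).not).or <|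
    ((hmod 2).and ((hmem _ (Primrec.fst.comp hunpair)).or
      (hmem _ (Primrec.snd.comp hunpair)))).or <| (hmod 3).and hdia

/-- The truth lists are computed by course-of-values recursion on the Gödel number. -/
theorem primrec_truthList : Primrec₂ truthList := by
  classical
  refine Primrec.nat_strong_rec truthList
    (g := fun a l => some ((List.range a.1).filter fun x => truthStep a l x)) ?_ fun a k => ?_
  · refine Primrec.option_some.comp ?_
    exact (PrimrecRel.listFilter (R := fun (x : ℕ) (p : (ℕ × ℕ × ℕ) × List (List ℕ)) =>
      truthStep p.1 p.2 x) (PrimrecRel.swap primrecPred_truthStep.primrecRel)).comp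
      (Primrec.list_range.comp (Primrec.fst.comp Primrec.fst)) Primrec.id
  · refine congrArg some (List.filter_congr fun x hx => ?_)
    simp only [truthStep_iff (List.mem_range.1 hx)]

theorem primrec_typeBound : Primrec₂ typeBound := by
  refine (Primrec.nat_rec (f := fun _ : ℕ => 1) (g := fun v p => 2 ^ (v + p.2))
    (Primrec.const 1) ?_).of_eq fun v k => ?_
  · exact primrec_pow.comp (Primrec.const 2)
      (Primrec.nat_add.comp Primrec.fst (Primrec.snd.comp Primrec.snd))
  · induction k with
    | zero => rfl
    | succ k ih => simp only [typeBound, ← ih]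

theorem primrec_modelSize : Primrec modelSize :=
  primrec_pow.comp (Primrec.nat_add.comp (primrec_typeBound.comp Primrec.id Primrec.succ)
    (Primrec.nat_add.comp Primrec.id (Primrec.const 2))) (Primrec.const 2)

/-- Whether a formula has a countermodel of bounded size whose accessibility relation satisfies
finitely many given conditions `Rᵐ ⊆ Rⁿ` is primitive recursive in the Gödel number. -/
theorem primrecPred_exists_countermodel {F : Set (ℕ × ℕ)} (hfin : F.Finite)
    (hF : ∀ p ∈ F, 1 ≤ p.1) : PrimrecPred fun e : ℕ =>
      ∃ c < 2 ^ modelSize e ^ 2, ∃ d < 2 ^ modelSize e ^ 2, ∃ w < modelSize e,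
        (∀ p ∈ F, ∀ x y, relPow (bitRel (modelSize e) c) p.1 x y →
          relPow (bitRel (modelSize e) c) p.2 x y) ∧
        ¬ (ofNat e).Sat (bitRel (modelSize e) c) (bitVal d) w := by
  have hB : Primrec fun e => 2 ^ modelSize e ^ 2 :=
    primrec_pow.comp (Primrec.const 2) (primrec_pow.comp primrec_modelSize (Primrec.const 2))
  have key : PrimrecPred fun e : ℕ =>
      ∃ c < 2 ^ modelSize e ^ 2, ∃ d < 2 ^ modelSize e ^ 2, ∃ w < modelSize e,
        (∀ p ∈ F, ∀ x y, relPow (bitRel (modelSize e) c) p.1 x y →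
          relPow (bitRel (modelSize e) c) p.2 x y) ∧ ¬ w ∈ truthList (modelSize e, c, d) e := by
    refine PrimrecRel.exists_lt_of_primrec hB
      (PrimrecRel.exists_lt_of_primrec (f := fun p : ℕ × ℕ => 2 ^ modelSize p.1 ^ 2)
        (P := fun p d => ∃ w < modelSize p.1,
          (∀ q ∈ F, ∀ x y, relPow (bitRel (modelSize p.1) p.2) q.1 x y →
            relPow (bitRel (modelSize p.1) p.2) q.2 x y) ∧
          ¬ w ∈ truthList (modelSize p.1, p.2, d) p.1)
        (hB.comp Primrec.fst)
        (PrimrecRel.exists_lt_of_primrec (f := fun p : (ℕ × ℕ) × ℕ => modelSize p.1.1)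
          (P := fun p w =>
            (∀ q ∈ F, ∀ x y, relPow (bitRel (modelSize p.1.1) p.1.2) q.1 x y →
              relPow (bitRel (modelSize p.1.1) p.1.2) q.2 x y) ∧
            ¬ w ∈ truthList (modelSize p.1.1, p.1.2, p.2) p.1.1)
          (primrec_modelSize.comp (Primrec.fst.comp Primrec.fst)) ?_))
    have he : Primrec fun p : ((ℕ × ℕ) × ℕ) × ℕ => p.1.1.1 :=
      Primrec.fst.comp (Primrec.fst.comp Primrec.fst)
    have hc : Primrec fun p : ((ℕ × ℕ) × ℕ) × ℕ => p.1.1.2 :=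
      Primrec.snd.comp (Primrec.fst.comp Primrec.fst)
    have hN := primrec_modelSize.comp he
    refine (primrecPred_relPow_subset_of_finite hN hc hfin hF).and (PrimrecPred.not ?_)
    have hl := primrec_truthList.comp
      (hN.pair (hc.pair (Primrec.snd.comp (α := ((ℕ × ℕ) × ℕ) × ℕ) Primrec.fst))) he
    exact ((PrimrecRel.exists_mem_list (R := fun y x : ℕ => y = x) Primrec.eq).comp hl
      Primrec.snd).of_eq fun p => by simp
  refine key.of_eq fun e => ?_
  simp only [mem_truthList]
  refine exists_congr fun c => and_congr_right fun _ => exists_congr fun d =>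
    and_congr_right fun _ => exists_congr fun w => and_congr_right fun hw => ?_
  simp only [hw, true_and]

theorem mainTheorem2 (Φ : Set ModalFormula) (hfin : Φ.Finite)
    (hΦ : ∀ φ ∈ Φ, ∃ m n i : ℕ, 1 < m ∧ m < n ∧
      φ = ((ModalFormula.var i).diaPow m).imp ((ModalFormula.var i).diaPow n)) :
    IsDecidableLogic (normalExtension Φ) := by
  choose! m n i hm hmn hΦ using hΦ
  set F : Set (ℕ × ℕ) := (fun φ => (m φ, n φ)) '' Φ with hFdef
  have hFfin : F.Finite := hfin.image _
  have hF : ∀ p ∈ F, 1 ≤ p.1 ∧ p.1 < p.2 := by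
    rintro _ ⟨φ, hφ, rfl⟩
    exact ⟨(hm φ hφ).le, hmn φ hφ⟩
  have hdec : PrimrecPred fun φ : ModalFormula => φ ∈ normalExtension Φ := by
    refine ((primrecPred_exists_countermodel hFfin fun p hp => (hF p hp).1).comp
      (Primrec.encode (α := ModalFormula))).not.of_eq fun φ => ?_
    have hcode : Encodable.encode φ = φ.toNat := rfl
    rw [hcode, ofNat_toNat, not_iff_comm]
    have hL := isNormalModalLogic_normalExtension Φ
    constructor
    · intro hφ
      obtain ⟨T, hT⟩ := hL.exists_not_sat hφ
      refine exists_bit_model hF ?_ hT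
      rintro _ ⟨ψ, hψ, rfl⟩ U U' hU
      refine CanonicalWorld.relPow_of_axiom_mem hL (i := i ψ) ?_ hU
      intro L _ hΦL
      exact hΦ ψ hψ ▸ hΦL hψ
    · rintro ⟨c, -, d, -, w, -, hR, hw⟩ hφ
      refine hw (hφ _ (isNormalModalLogic_valid (bitRel (modelSize φ.toNat) c))
        (fun ψ hψ V x => ?_) (bitVal d) w)
      rw [hΦ ψ hψ, sat_imp, sat_diaPow, sat_diaPow]
      rintro ⟨y, hxy, hy⟩
      exact ⟨y, hR _ ⟨ψ, hψ, rfl⟩ x y hxy, hy⟩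
  obtain ⟨inst, h⟩ := hdec
  exact ⟨inst, h.to_comp⟩
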